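/- **Theorem (Stability of Periodic Merge Trees).** *Setting.* Let $K$ be a locally finite cell complex in $\mathbb{R}^d$: every cell is homeomorphic to a closed ball of dimension $p\le d$, its boundary is a union of lower-dimensional cells of $K$ (its faces), and any two cells intersect in a (possibly empty) union of common faces, where a cell counts as a face of itself. Let $\Lambda\subseteq\mathbb{R}^d$ be a $d$-dimensional lattice. A *filter* is a function $f\colon K\to\mathbb{R}$ on the cells with $f(\sigma)\le f(\tau)$ whenever $\sigma$ is a face of $\tau$, and $K_t$ is the union of the cells with $f\le t$. The complex $K$ is *$\Lambda$-periodic* if $\sigma+u\in K$ for all $\sigma\in K$, $u\in\Lambda$, and then $f$ is *$\Lambda$-periodic* if $f(\sigma+u)=f(\sigma)$ for all such $\sigma,u$. *Periodic merge tree.* Let $\pi\colon\mathbb{R}^d\to\mathbb{R}^d/\Lambda$ be the projection and $(K/\Lambda)_t=\pi(K_t)$. The periodic merge tree $M(f,\Lambda)$ is the quotient space of $\{(x,s) : x\in (K/\Lambda)_s\}\subseteq \mathbb{R}^d/\Lambda\times\mathbb{R}$ by the relation $(x,s)\sim(y,t)$ iff $s=t$ and $x,y$ lie in the same connected component of $(K/\Lambda)_s$.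 So its points of height $h=s$ are the connected components of $(K/\Lambda)_s$; a point $B$ *covers* $A$ if $h(A)\le h(B)$ and $A\subseteq B$. For a point $C$, let $\Lambda_C$ be the lattice of all $u\in\Lambda$ that leave every connected component of $\pi^{-1}(C)$ invariant, and let $p$ be its dimension. The frequency of $C$ is the monomial $$F(C)=\frac{\mathrm{vol}_p(\Lambda_C)}{\mathrm{vol}_d(\Lambda)}\,\nu_{d-p}R^{d-p}$$ in the variable $R$, where $\mathrm{vol}_q$ is the $q$-dimensional volume of a unit cell and $\nu_q$ the volume of the unit ball of $\mathbb{R}^q$. Monomials are ordered by exponent first, then by coefficient. *Interleaving distance.* Let $M,M'$ be periodic merge trees, or subtrees of such, with heights $h,h'$ and frequencies $F,F'$. Continuous maps $\varphi\colon M\to M'$ and $\psi\colon M'\to M$ are *$\varepsilon$-compatible* if, for all $C\in M$, $C'\in M'$: $h'(\varphi(C))=h(C)+\varepsilon$ and $h(\psi(C'))=h'(C')+\varepsilon$; $\psi(\varphi(C))$ covers $C$ and $\varphi(\psi(C'))$ covers $C'$; $F'(\varphi(C))\le F(C)$ and $F(\psi(C'))\le F'(C')$. The interleaving distance $I(M,M')\in[0,\infty]$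 is the infimum of the $\varepsilon\ge0$ for which $\varepsilon$-compatible maps exist. *Splintering.* For $C\in M$, the *subtree* $M_C$ consists of the points covered by $C$. The tree $M'$ *splinters* $M$ if there is a continuous surjection $\omega\colon M'\to M$ with $h\circ\omega=h'$ such that for every $C\in M$ the set $\omega^{-1}(C)$ is finite, and for all $A,B\in\omega^{-1}(C)$: $I(M'_A,M'_B)=0$, $\omega(M'_A)=M_C$, and $F'(A)=F(C)/\#\omega^{-1}(C)$. Periodic merge trees $M,N$ (arising in $\mathbb{R}^d$) are *equivalent*, $M\simeq N$, if some periodic merge tree (arising in $\mathbb{R}^d$) splinters both; $[M]$ is the class of the periodic merge trees equivalent to $M$. The interleaving pseudo-distance is $$J([M],[M'])=\inf\sum_{i=1}^k I(M_i,M_i'),$$ the infimum over all $k\ge1$ and all periodic merge trees $M_i,M_i'$ (arising in $\mathbb{R}^d$) with $M_1\in[M]$, $M_k'\in[M']$, and $M_i'\simeq M_{i+1}$ for $1\le i<k$. *Statement.* Let $\Lambda\subseteq\mathbb{R}^d$ be a $d$-dimensional lattice, $K$ a $\Lambda$-periodic complex, and $f,g\colon K\to\mathbb{R}$ two $\Lambda$-periodic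 filters. Then $$I\big(M(f,\Lambda),M(g,\Lambda)\big)\le\|f-g\|_\infty \quad\text{and}\quad J\big([M(f,\Lambda)],[M(g,\Lambda)]\big)\le\|f-g\|_\infty,$$ where $\|f-g\|_\infty=\sup_{\sigma\in K}|f(\sigma)-g(\sigma)|$. -/

import Mathlib

open MeasureTheory Set
open scoped ENNReal NNReal

namespace PeriodicMerge

/-- Euclidean `d`-space. -/
abbrev Space (d : ℕ) : Type := EuclideanSpace ℝ (Fin d)

/-! ### Cell complexes and filters -/

/-- `σ` is homeomorphic to the closed unit ball of `ℝᵖ`, and `b` is the part of `σ` that corresponds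
to the unit sphere (so `b` is empty if `p = 0`). -/
def IsClosedCell {d : ℕ} (p : ℕ) (σ b : Set (Space d)) : Prop :=
  ∃ h : Metric.closedBall (0 : Space p) 1 ≃ₜ σ,
    b = {x | ∃ y : Metric.closedBall (0 : Space p) 1, ‖(y : Space p)‖ = 1 ∧ (h y : Space d) = x}

/-- A locally finite cell complex in `ℝᵈ`. The dimension and the boundary of a cell are recorded as
data; both are determined by the cell as a topological space. -/
structure CellComplex (d : ℕ) where
  /-- the cells, as closed subsets of `ℝᵈ` -/
  cells : Set (Set (Space d))
  /-- the dimension of a cell -/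
  dim : cells → ℕ
  /-- the boundary of a cell -/
  bdry : cells → Set (Space d)
  dim_le : ∀ σ, dim σ ≤ d
  isClosedCell : ∀ σ, IsClosedCell (dim σ) (σ : Set (Space d)) (bdry σ)
  /-- the boundary of a cell is a union of lower-dimensional cells -/
  bdry_eq : ∀ σ, ∃ F : Set cells, (∀ ρ ∈ F, dim ρ < dim σ) ∧
    bdry σ = ⋃ ρ ∈ F, (ρ : Set (Space d))
  /-- two cells meet in a (possibly empty) union of cells, each of which is, for either of the two
  cells, that cell itself or a lower-dimensional cell in its boundary -/
  inter_eq : ∀ σ τ : cells, ∃ F : Set cells,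
    (∀ ρ ∈ F, (ρ = σ ∨ (dim ρ < dim σ ∧ (ρ : Set (Space d)) ⊆ bdry σ)) ∧
      (ρ = τ ∨ (dim ρ < dim τ ∧ (ρ : Set (Space d)) ⊆ bdry τ))) ∧
    (σ : Set (Space d)) ∩ τ = ⋃ ρ ∈ F, (ρ : Set (Space d))
  locallyFinite : LocallyFinite fun σ : cells => (σ : Set (Space d))

namespace CellComplex

variable {d : ℕ} (K : CellComplex d)

/-- `σ` is a (proper) face of `τ`. -/
def IsFace (σ τ : K.cells) : Prop :=
  K.dim σ < K.dim τ ∧ (σ : Set (Space d)) ⊆ K.bdry τ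

/-- A filter: a real function on the cells that does not decrease from a face to a cell. -/
def IsFilter (f : K.cells → ℝ) : Prop :=
  ∀ σ τ : K.cells, K.IsFace σ τ → f σ ≤ f τ

/-- The (underlying space of the) sublevel set `K_t` of `f`. -/
def sublevel (f : K.cells → ℝ) (t : ℝ) : Set (Space d) :=
  {x | ∃ σ : K.cells, f σ ≤ t ∧ x ∈ (σ : Set (Space d))}

/-- `K` is invariant under translations by vectors of `Λ`. -/
def IsPeriodic (Λ : Submodule ℤ (Space d)) : Prop :=
  ∀ σ ∈ K.cells, ∀ u ∈ Λ, (fun x => x + u) '' σ ∈ K.cells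

/-- `f` takes the same value on cells that are `Λ`-translates of each other. -/
def IsPeriodicFun (Λ : Submodule ℤ (Space d)) (f : K.cells → ℝ) : Prop :=
  ∀ σ τ : K.cells, ∀ u ∈ Λ, (τ : Set (Space d)) = (fun x => x + u) '' (σ : Set (Space d)) →
    f τ = f σ

/-- The sublevel set `(K/Λ)_t` of the quotient filter `f/Λ`, as a subset of the torus `ℝᵈ/Λ`.
A cell of `K/Λ` is the image of a cell `σ` of `K`, with value `f σ`, so this union of the cells of
`K/Λ` with value at most `t` is the image of `K_t`. -/
def torusSublevel (Λ : Submodule ℤ (Space d)) (f : K.cells → ℝ) (t : ℝ) : Set (Space d ⧸ Λ) :=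
  Λ.mkQ '' K.sublevel f t

end CellComplex

/-! ### Merge trees -/

section MergeTree

variable {X : Type} [TopologicalSpace X] (S : ℝ → Set X)

/-- The space of pairs `(x, s)` with `x ∈ S s`, as a subspace of `X × ℝ`. -/
abbrev SublevelSpace : Type := {p : X × ℝ // p.1 ∈ S p.2}

/-- `(x, s) ∼ (y, t)` if `s = t` and `x`, `y` lie in the same connected component of `S s`. -/
def mergeSetoid : Setoid (SublevelSpace S) where
  r p q := p.1.2 = q.1.2 ∧
    connectedComponentIn (S p.1.2) p.1.1 = connectedComponentIn (S q.1.2) q.1.1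
  iseqv := ⟨fun _ => ⟨rfl, rfl⟩, fun h => ⟨h.1.symm, h.2.symm⟩,
    fun h k => ⟨h.1.trans k.1, h.2.trans k.2⟩⟩

/-- The merge tree of the sublevel sets `S`. -/
def MergeTree : Type := Quotient (mergeSetoid S)

/-- The quotient topology. -/
instance : TopologicalSpace (MergeTree S) :=
  inferInstanceAs (TopologicalSpace (Quotient (mergeSetoid S)))

namespace MergeTree

variable {S}

/-- The height of a point of the merge tree. -/
def height : MergeTree S → ℝ :=
  Quotient.lift (fun p : SublevelSpace S => p.1.2) fun _ _ h => h.1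

/-- The connected component of `S s` that a point at height `s` of the merge tree stands for. -/
def component : MergeTree S → Set X :=
  Quotient.lift (fun p : SublevelSpace S => connectedComponentIn (S p.1.2) p.1.1) fun _ _ h => h.2

end MergeTree

end MergeTree

/-! ### Lattices and shadow monomials -/

/-- The `p`-dimensional volume of a unit cell of the `p`-dimensional lattice `L`: the covolume of
`L` in its real span `V`, for the Lebesgue measure of the Euclidean space `V` (which gives volume
`1` to the cube spanned by an orthonormal basis). -/
noncomputable def latticeVolume {d : ℕ} (L : Submodule ℤ (Space d)) : ℝ :=
  ZLattice.covolume
    (ZLattice.comap ℝ L (Submodule.span ℝ (L : Set (Space d))).subtype)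
    (stdOrthonormalBasis ℝ (Submodule.span ℝ (L : Set (Space d)))).toBasis.addHaar

/-- The volume of the unit ball of `ℝ^q`. -/
noncomputable def ballVolume (q : ℕ) : ℝ :=
  (volume (Metric.ball (0 : Space q) 1)).toReal

/-- The shadows of a subset `C` of the torus: the connected components of its preimage. -/
def IsShadow {d : ℕ} (Λ : Submodule ℤ (Space d)) (C : Set (Space d ⧸ Λ)) (c : Set (Space d)) :
    Prop :=
  ∃ x ∈ Λ.mkQ ⁻¹' C, c = connectedComponentIn (Λ.mkQ ⁻¹' C) x

/-- The periodicity lattice of `C`: the vectors of `Λ` that leave every shadow of `C` invariant. -/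
def periodicityLattice {d : ℕ} (Λ : Submodule ℤ (Space d)) (C : Set (Space d ⧸ Λ)) :
    Submodule ℤ (Space d) :=
  AddSubgroup.toIntSubmodule
    { carrier := {u | u ∈ Λ ∧ ∀ c, IsShadow Λ C c → (fun x => x + u) '' c = c}
      zero_mem' := ⟨Λ.zero_mem, fun c _ => by simp⟩
      add_mem' := by
        rintro u v ⟨hu, hu'⟩ ⟨hv, hv'⟩
        refine ⟨Λ.add_mem hu hv, fun c hc => ?_⟩
        have h : (fun x => x + (u + v)) '' c = (fun x => x + v) '' ((fun x => x + u) '' c) := by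
          rw [Set.image_image]
          simp only [add_assoc]
        rw [h, hu' c hc, hv' c hc]
      neg_mem' := by
        rintro u ⟨hu, hu'⟩
        refine ⟨Λ.neg_mem hu, fun c hc => ?_⟩
        conv_lhs => rw [← hu' c hc]
        rw [Set.image_image]
        simp }

/-- The monomial `coeff * R ^ exp` in the variable `R`. -/
@[ext]
structure Monomial where
  coeff : ℝ
  exp : ℕ

namespace Monomial

/-- Monomials are compared by exponent first and by coefficient second. -/
instance : LE Monomial :=
  ⟨fun m n => m.exp < n.exp ∨ (m.exp = n.exp ∧ m.coeff ≤ n.coeff)⟩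

/-- The monomial divided by a natural number. -/
noncomputable def divNat (m : Monomial) (k : ℕ) : Monomial :=
  ⟨m.coeff / k, m.exp⟩

end Monomial

/-- The shadow monomial `vol_p(Λ_C) / vol_d(Λ) * ν_{d-p} R^{d-p}` of `C`, where `p ≤ d` is the
dimension of the periodicity lattice `Λ_C`. -/
noncomputable def shadowMonomial {d : ℕ} (Λ : Submodule ℤ (Space d)) (C : Set (Space d ⧸ Λ)) :
    Monomial where
  coeff := latticeVolume (periodicityLattice Λ C) / latticeVolume Λ *
    ballVolume (d - Module.finrank ℤ (periodicityLattice Λ C))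
  exp := d - Module.finrank ℤ (periodicityLattice Λ C)

/-! ### Periodic merge trees and the interleaving distance -/

/-- A space with a height function, a covering relation, and a frequency function. This is only the
common type of periodic merge trees and of their subtrees. -/
structure DecoratedTree where
  carrier : Type
  [top : TopologicalSpace carrier]
  height : carrier → ℝ
  /-- `covers b a` reads: `b` covers `a` -/
  covers : carrier → carrier → Prop
  freq : carrier → Monomial

attribute [instance] DecoratedTree.top

/-- The periodic merge tree of `f` with respect to `Λ`: the merge tree of the quotient filter, with
each point decorated by the shadow monomial of the component that it stands for. -/
noncomputable def periodicMergeTree {d : ℕ} (Λ : Submodule ℤ (Space d)) (K : CellComplex d)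
    (f : K.cells → ℝ) : DecoratedTree where
  carrier := MergeTree (K.torusSublevel Λ f)
  height := MergeTree.height
  covers b a := a.height ≤ b.height ∧ a.component ⊆ b.component
  freq a := shadowMonomial Λ a.component

/-- The subtree with topmost point `c`: all points covered by `c`. -/
def DecoratedTree.subtree (T : DecoratedTree) (c : T.carrier) : DecoratedTree where
  carrier := {a : T.carrier // T.covers c a}
  height a := T.height a.1
  covers b a := T.covers b.1 a.1
  freq a := T.freq a.1

/-- `φ` and `ψ` are `ε`-compatible. -/
structure Compatible (T T' : DecoratedTree) (ε : ℝ≥0) (φ : T.carrier → T'.carrier)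
    (ψ : T'.carrier → T.carrier) : Prop where
  continuous_left : Continuous φ
  continuous_right : Continuous ψ
  height_left : ∀ c, T'.height (φ c) = T.height c + ε
  height_right : ∀ c', T.height (ψ c') = T'.height c' + ε
  covers_left : ∀ c, T.covers (ψ (φ c)) c
  covers_right : ∀ c', T'.covers (φ (ψ c')) c'
  freq_left : ∀ c, T'.freq (φ c) ≤ T.freq c
  freq_right : ∀ c', T.freq (ψ c') ≤ T'.freq c'

/-- The interleaving distance, the infimum of the `ε ≥ 0` that admit `ε`-compatible maps
(`∞` if there is no such `ε`). -/
noncomputable def interleavingDist (T T' : DecoratedTree) : ℝ≥0∞ :=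
  ⨅ (ε : ℝ≥0) (_ : ∃ φ ψ, Compatible T T' ε φ ψ), (ε : ℝ≥0∞)

/-! ### Splintering and the interleaving pseudo-distance -/

/-- `T'` splinters `T`. -/
def Splinters (T' T : DecoratedTree) : Prop :=
  ∃ ω : T'.carrier → T.carrier, Continuous ω ∧ Function.Surjective ω ∧
    (∀ a, T.height (ω a) = T'.height a) ∧
    ∀ c : T.carrier, (ω ⁻¹' {c}).Finite ∧
      (∀ a ∈ ω ⁻¹' {c}, ∀ b ∈ ω ⁻¹' {c},
        interleavingDist (T'.subtree a) (T'.subtree b) = 0) ∧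
      ∀ a ∈ ω ⁻¹' {c}, ω '' {x | T'.covers a x} = {y | T.covers c y} ∧
        T'.freq a = (T.freq c).divNat (ω ⁻¹' {c}).ncard

/-- `T` is the periodic merge tree of some periodic filter on a complex in `ℝᵈ`. -/
def IsPeriodicMergeTree (d : ℕ) (T : DecoratedTree) : Prop :=
  ∃ (Λ : Submodule ℤ (Space d)) (_ : DiscreteTopology Λ) (_ : IsZLattice ℝ Λ)
    (K : CellComplex d) (f : K.cells → ℝ),
    K.IsPeriodic Λ ∧ K.IsFilter f ∧ K.IsPeriodicFun Λ f ∧ T = periodicMergeTree Λ K f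

/-- Two trees are equivalent if some periodic merge tree splinters both. -/
def SplinterEquiv (d : ℕ) (T T' : DecoratedTree) : Prop :=
  ∃ N, IsPeriodicMergeTree d N ∧ Splinters N T ∧ Splinters N T'

/-- The class of all periodic merge trees that are equivalent to `T`. -/
def splinterClass (d : ℕ) (T : DecoratedTree) : Set DecoratedTree :=
  {N | IsPeriodicMergeTree d N ∧ SplinterEquiv d N T}

/-- The interleaving pseudo-distance between two classes of periodic merge trees: the infimum of
`∑ i, interleavingDist (M i) (M' i)` over all finite non-empty sequences of pairs `M i`, `M' i` of
periodic merge trees that start in `A`, end in `B`, and for which `M' i` is equivalent to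
`M (i + 1)`. -/
noncomputable def interleavingPseudoDist (d : ℕ) (A B : Set DecoratedTree) : ℝ≥0∞ :=
  sInf {r | ∃ (k : ℕ) (M M' : Fin (k + 1) → DecoratedTree),
    (∀ i, IsPeriodicMergeTree d (M i)) ∧ (∀ i, IsPeriodicMergeTree d (M' i)) ∧
    M 0 ∈ A ∧ M' (Fin.last k) ∈ B ∧
    (∀ i : Fin k, SplinterEquiv d (M' i.castSucc) (M i.succ)) ∧
    r = ∑ i, interleavingDist (M i) (M' i)}

/-- The supremum norm of `f - g`. -/
noncomputable def supDist {ι : Type} (f g : ι → ℝ) : ℝ≥0∞ :=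
  ⨆ σ, ENNReal.ofReal |f σ - g σ|

end PeriodicMerge

open PeriodicMerge

namespace PeriodicMerge

variable {d : ℕ}

/-! ### Lattice volumes -/

/-! Let ε = ‖f - g‖_∞ be finite. Each sublevel set of `f` at height s lies in that of `g` at s + ε,
and conversely, so sending a component to the one that contains it ε higher gives continuous maps in
both directions (`MergeTree.shift`). The height and covering conditions are immediate; the content
is that frequencies do not increase.

Two facts give this. If C is a nonempty subset of a component C' of a sublevel set, then Λ_C ⊆
Λ_{C'} (`CellComplex.periodicityLattice_mono`): every shadow of C' projects onto all of C'
(`CellComplex.image_shadow`), so it contains a shadow of C, and a translation in Λ that preserves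
the small shadow must preserve the large one. Secondly, enlarging the lattice either raises its
rank, which lowers the exponent, or keeps the rank and divides the volume by the index
(`shadowMonomial_anti`).

The bound on J follows from the bound on I by a chain with a single pair. -/

theorem finrank_eq_finrank_span (L : Submodule ℤ (Space d)) [DiscreteTopology L] :
    Module.finrank ℤ L = Module.finrank ℝ (Submodule.span ℝ (L : Set (Space d))) := by
  have hL : Submodule.span ℤ (L : Set (Space d)) = L := Submodule.span_eq L
  have h := Real.finrank_eq_int_finrank_of_discrete (s := (L : Set (Space d)))
    (by rw [hL]; infer_instance)
  rw [Set.finrank, Set.finrank, hL] at h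
  exact h.symm

/-- The covolume of a lattice does not increase when the lattice grows inside a fixed space. -/
theorem covolume_anti {E : Type*} [NormedAddCommGroup E] [InnerProductSpace ℝ E]
    [FiniteDimensional ℝ E] [MeasurableSpace E] [BorelSpace E] {L₁ L₂ : Submodule ℤ E}
    [DiscreteTopology L₁] [IsZLattice ℝ L₁] [DiscreteTopology L₂] [IsZLattice ℝ L₂]
    (h : L₁ ≤ L₂) : ZLattice.covolume L₂ ≤ ZLattice.covolume L₁ := by
  have h₁ := ZLattice.covolume_pos L₁
  have h₂ := ZLattice.covolume_pos L₂
  have hdiv := ZLattice.covolume_div_covolume_eq_relIndex' L₁ L₂ h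
  have hpos : 0 < ZLattice.covolume L₁ / ZLattice.covolume L₂ := div_pos h₁ h₂
  -- The ratio of covolumes is the index, a natural number; being positive, it is at least 1.
  rw [hdiv, Nat.cast_pos] at hpos
  rw [← one_le_div h₂, hdiv]
  exact_mod_cast hpos

theorem latticeVolume_nonneg (L : Submodule ℤ (Space d)) : 0 ≤ latticeVolume L :=
  ENNReal.toReal_nonneg

/-- The volume `latticeVolume L`, computed in a space `V` that is known to be the span of `L`. -/
theorem latticeVolume_eq_covolume (L : Submodule ℤ (Space d)) (V : Submodule ℝ (Space d))
    (hV : Submodule.span ℝ (L : Set (Space d)) = V) :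
    latticeVolume L = ZLattice.covolume (ZLattice.comap ℝ L V.subtype) := by
  subst hV
  rw [latticeVolume, OrthonormalBasis.addHaar_eq_volume]

theorem isZLattice_comap_subtype (L : Submodule ℤ (Space d)) [DiscreteTopology L]
    (V : Submodule ℝ (Space d)) (hV : Submodule.span ℝ (L : Set (Space d)) = V)
    [DiscreteTopology (ZLattice.comap ℝ L V.subtype)] :
    IsZLattice ℝ (ZLattice.comap ℝ L V.subtype) where
  span_top := by
    subst hV
    exact Submodule.span_span_coe_preimage

/-- Equal ranks force equal real spans, so both volumes are covolumes of full lattices in one common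
space V. -/
theorem latticeVolume_anti {L₁ L₂ : Submodule ℤ (Space d)} [DiscreteTopology L₁]
    [DiscreteTopology L₂] (h : L₁ ≤ L₂)
    (hrank : Module.finrank ℤ L₁ = Module.finrank ℤ L₂) :
    latticeVolume L₂ ≤ latticeVolume L₁ := by
  have hspan : Submodule.span ℝ (L₁ : Set (Space d)) = Submodule.span ℝ (L₂ : Set (Space d)) :=
    Submodule.eq_of_le_of_finrank_eq (Submodule.span_mono h)
      (by rw [← finrank_eq_finrank_span, ← finrank_eq_finrank_span, hrank])
  set V := Submodule.span ℝ (L₂ : Set (Space d)) with hV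
  have d₁ : DiscreteTopology (ZLattice.comap ℝ L₁ V.subtype) :=
    ZLattice.comap_discreteTopology ℝ L₁ continuous_subtype_val Subtype.val_injective
  have d₂ : DiscreteTopology (ZLattice.comap ℝ L₂ V.subtype) :=
    ZLattice.comap_discreteTopology ℝ L₂ continuous_subtype_val Subtype.val_injective
  have z₁ := isZLattice_comap_subtype L₁ V hspan
  have z₂ := isZLattice_comap_subtype L₂ V hV.symm
  rw [latticeVolume_eq_covolume L₁ V hspan, latticeVolume_eq_covolume L₂ V hV.symm]
  exact covolume_anti fun x hx => h hx

/-! ### Shadow monomials -/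

theorem Monomial.le_refl (m : Monomial) : m ≤ m :=
  Or.inr ⟨rfl, _root_.le_refl _⟩

theorem periodicityLattice_le (Λ : Submodule ℤ (Space d)) (C : Set (Space d ⧸ Λ)) :
    periodicityLattice Λ C ≤ Λ :=
  fun _ hu => hu.1

theorem discreteTopology_of_le {L₁ L₂ : Submodule ℤ (Space d)} [DiscreteTopology L₂]
    (h : L₁ ≤ L₂) : DiscreteTopology L₁ :=
  DiscreteTopology.of_subset (s := (L₂ : Set (Space d))) ‹_› h

theorem finrank_le_of_le {L₁ L₂ : Submodule ℤ (Space d)} [DiscreteTopology L₁]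
    [DiscreteTopology L₂] (h : L₁ ≤ L₂) : Module.finrank ℤ L₁ ≤ Module.finrank ℤ L₂ := by
  rw [finrank_eq_finrank_span, finrank_eq_finrank_span]
  exact Submodule.finrank_mono (Submodule.span_mono h)

theorem finrank_le_dim (L : Submodule ℤ (Space d)) [DiscreteTopology L] :
    Module.finrank ℤ L ≤ d := by
  rw [finrank_eq_finrank_span]
  simpa using Submodule.finrank_le (Submodule.span ℝ (L : Set (Space d)))

/-- The shadow monomial does not increase when the periodicity lattice grows. -/
theorem shadowMonomial_anti (Λ : Submodule ℤ (Space d)) [DiscreteTopology Λ]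
    {C C' : Set (Space d ⧸ Λ)} (h : periodicityLattice Λ C ≤ periodicityLattice Λ C') :
    shadowMonomial Λ C' ≤ shadowMonomial Λ C := by
  have := discreteTopology_of_le (periodicityLattice_le Λ C)
  have := discreteTopology_of_le (periodicityLattice_le Λ C')
  rcases (finrank_le_of_le h).lt_or_eq with hlt | heq
  -- Subtraction is truncated: the exponent drops strictly only because the larger rank is still at
  -- most `d`.
  · have := finrank_le_dim (periodicityLattice Λ C')
    exact Or.inl (show d - _ < d - _ by omega)
  · refine Or.inr ⟨show d - _ = d - _ by rw [heq], ?_⟩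
    change _ / _ * ballVolume _ ≤ _ / _ * ballVolume _
    rw [heq]
    exact mul_le_mul_of_nonneg_right
      (div_le_div_of_nonneg_right (latticeVolume_anti h heq) (latticeVolume_nonneg Λ))
      ENNReal.toReal_nonneg

/-! ### Cells and components -/

theorem IsClosedCell.isCompact {p : ℕ} {σ b : Set (Space d)} (h : IsClosedCell p σ b) :
    IsCompact σ := by
  obtain ⟨e, -⟩ := h
  have : CompactSpace (Metric.closedBall (0 : Space p) 1) :=
    isCompact_iff_compactSpace.mp (isCompact_closedBall _ _)
  exact isCompact_iff_compactSpace.mpr e.compactSpace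

theorem IsClosedCell.isPreconnected {p : ℕ} {σ b : Set (Space d)} (h : IsClosedCell p σ b) :
    IsPreconnected σ := by
  obtain ⟨e, -⟩ := h
  have : PreconnectedSpace (Metric.closedBall (0 : Space p) 1) :=
    isPreconnected_iff_preconnectedSpace.mp (convex_closedBall _ _).isPreconnected
  exact isPreconnected_iff_preconnectedSpace.mpr
    (e.surjective.denseRange.preconnectedSpace e.continuous)

theorem image_connectedComponentIn_add (P : Set (Space d)) (u y : Space d) (hy : y ∈ P)
    (hP : (fun x => x + u) '' P = P) :
    (fun x => x + u) '' connectedComponentIn P y = connectedComponentIn P (y + u) := by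
  have h := (Homeomorph.addRight u).image_connectedComponentIn hy
  simpa [hP] using h

theorem mkQ_add_of_mem (Λ : Submodule ℤ (Space d)) {u : Space d} (hu : u ∈ Λ) (x : Space d) :
    Λ.mkQ (x + u) = Λ.mkQ x := by
  rw [map_add, (Submodule.mkQ_apply Λ u).trans ((Submodule.Quotient.mk_eq_zero Λ).2 hu), add_zero]

theorem exists_add_of_mkQ_eq (Λ : Submodule ℤ (Space d)) {x y : Space d}
    (h : Λ.mkQ x = Λ.mkQ y) : ∃ u ∈ Λ, y = x + u :=
  ⟨y - x, (Submodule.Quotient.eq Λ).1 h.symm, by abel⟩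

theorem image_add_preimage_mkQ (Λ : Submodule ℤ (Space d)) (C : Set (Space d ⧸ Λ))
    {u : Space d} (hu : u ∈ Λ) : (fun x => x + u) '' (Λ.mkQ ⁻¹' C) = Λ.mkQ ⁻¹' C := by
  ext x
  constructor
  · rintro ⟨y, hy, rfl⟩
    rwa [mem_preimage, mkQ_add_of_mem Λ hu]
  · intro hx
    refine ⟨x + -u, ?_, by simp⟩
    rwa [mem_preimage, mkQ_add_of_mem Λ (Λ.neg_mem hu)]

namespace CellComplex

variable (K : CellComplex d)

/-- A union of cells is closed. -/
theorem isClosed_of_union {A : Set (Space d)}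
    (hA : ∀ x ∈ A, ∃ σ : K.cells, x ∈ (σ : Set (Space d)) ∧ (σ : Set (Space d)) ⊆ A) :
    IsClosed A := by
  have hU : A = ⋃ σ : {σ : K.cells // (σ : Set (Space d)) ⊆ A}, (σ.1 : Set (Space d)) := by
    ext x
    simp only [mem_iUnion]
    exact ⟨fun hx => let ⟨σ, h₁, h₂⟩ := hA x hx; ⟨⟨σ, h₂⟩, h₁⟩, fun ⟨σ, h⟩ => σ.2 h⟩
  rw [hU]
  exact (K.locallyFinite.comp_injective Subtype.val_injective).isClosed_iUnion
    fun σ => (K.isClosedCell σ.1).isCompact.isClosed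

variable {K} {Λ : Submodule ℤ (Space d)} {f : K.cells → ℝ}

theorem exists_translate (hK : K.IsPeriodic Λ) (hf : K.IsPeriodicFun Λ f) (σ : K.cells)
    {u : Space d} (hu : u ∈ Λ) :
    ∃ τ : K.cells, (τ : Set (Space d)) = (fun x => x + u) '' (σ : Set (Space d)) ∧ f τ = f σ :=
  ⟨⟨_, hK σ σ.2 u hu⟩, rfl, hf σ _ u hu rfl⟩

/-- By periodicity K_t is a union of Λ-orbits, so projecting and pulling back adds nothing. -/
theorem preimage_torusSublevel (hK : K.IsPeriodic Λ) (hf : K.IsPeriodicFun Λ f) (t : ℝ) :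
    Λ.mkQ ⁻¹' K.torusSublevel Λ f t = K.sublevel f t := by
  refine (subset_preimage_image _ _).antisymm' ?_
  rintro x ⟨y, ⟨σ, hσ, hy⟩, hyx⟩
  obtain ⟨u, hu, rfl⟩ := exists_add_of_mkQ_eq Λ hyx
  obtain ⟨τ, hτ, hfτ⟩ := exists_translate hK hf σ hu
  exact ⟨τ, hfτ.trans_le hσ, hτ ▸ mem_image_of_mem _ hy⟩

/-- Every shadow of a component of a sublevel set of the torus projects onto that component. -/
theorem image_shadow (hK : K.IsPeriodic Λ) (hf : K.IsPeriodicFun Λ f) (t : ℝ)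
    {x₀ : Space d ⧸ Λ} {c : Set (Space d)}
    (hc : IsShadow Λ (connectedComponentIn (K.torusSublevel Λ f t) x₀) c) :
    Λ.mkQ '' c = connectedComponentIn (K.torusSublevel Λ f t) x₀ := by
  obtain ⟨y, hy, rfl⟩ := hc
  set C := connectedComponentIn (K.torusSublevel Λ f t) x₀ with hC
  set P := Λ.mkQ ⁻¹' C with hP
  set c := connectedComponentIn P y with hcdef
  have hcP : c ⊆ P := connectedComponentIn_subset _ _
  have hPS : P ⊆ K.sublevel f t := by
    rw [← preimage_torusSublevel hK hf]
    exact preimage_mono (connectedComponentIn_subset _ _)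
  -- A cell is connected, so its image in the torus cannot leave the component C.
  have cell_P : ∀ σ : K.cells, f σ ≤ t → ∀ x ∈ (σ : Set (Space d)), x ∈ P →
      (σ : Set (Space d)) ⊆ P := by
    intro σ hσ x hx hxP
    have hsub : Λ.mkQ '' (σ : Set (Space d)) ⊆ C := by
      rw [hC, connectedComponentIn_eq (show Λ.mkQ x ∈ _ from hxP)]
      exact ((K.isClosedCell σ).isPreconnected.image _
        Λ.continuous_mkQ.continuousOn).subset_connectedComponentIn (mem_image_of_mem _ hx)
        (image_mono fun z hz => ⟨σ, hσ, hz⟩)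
    exact image_subset_iff.1 hsub
  have cell_c : ∀ σ : K.cells, f σ ≤ t → ∀ x ∈ (σ : Set (Space d)), x ∈ c →
      (σ : Set (Space d)) ⊆ c := by
    intro σ hσ x hx hxc
    rw [hcdef, connectedComponentIn_eq (show x ∈ _ from hxc)]
    exact (K.isClosedCell σ).isPreconnected.subset_connectedComponentIn hx
      (cell_P σ hσ x hx (hcP hxc))
  -- D is the union of the Λ-translates of c. A cell of K_t meeting D can be translated to meet c,
  -- hence lies in c, so the original cell lies in D.
  set D := Λ.mkQ ⁻¹' (Λ.mkQ '' c) with hD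
  have cell_D : ∀ σ : K.cells, f σ ≤ t → ∀ x ∈ (σ : Set (Space d)), x ∈ D →
      (σ : Set (Space d)) ⊆ D := by
    rintro σ hσ x hx ⟨z, hz, hzx⟩
    obtain ⟨u, hu, rfl⟩ := exists_add_of_mkQ_eq Λ hzx.symm
    obtain ⟨τ, hτ, hfτ⟩ := exists_translate hK hf σ hu
    have hsub := cell_c τ (hfτ.trans_le hσ) _ (hτ ▸ mem_image_of_mem _ hx) hz
    intro w hw
    exact ⟨w + u, hsub (hτ ▸ mem_image_of_mem _ hw), mkQ_add_of_mem Λ hu w⟩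
  have hcC : Λ.mkQ '' c ⊆ C := image_subset_iff.2 hcP
  -- Closedness in the torus is tested on preimages. Both D and P \ D are unions of cells, hence
  -- closed by local finiteness; connectedness of C then leaves no room for the second piece.
  have hDclosed : IsClosed (Λ.mkQ '' c) := by
    rw [← Λ.isQuotientMap_mkQ.isClosed_preimage]
    refine K.isClosed_of_union fun x hx => ?_
    obtain ⟨σ, hσ, hxσ⟩ := hPS (show x ∈ P from hcC hx)
    exact ⟨σ, hxσ, cell_D σ hσ x hxσ hx⟩
  have hD'closed : IsClosed (C \ Λ.mkQ '' c) := by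
    rw [← Λ.isQuotientMap_mkQ.isClosed_preimage]
    refine K.isClosed_of_union fun x hx => ?_
    obtain ⟨σ, hσ, hxσ⟩ := hPS (show x ∈ P from hx.1)
    exact ⟨σ, hxσ, fun w hw => ⟨cell_P σ hσ x hxσ hx.1 hw,
      fun hwD => hx.2 (cell_D σ hσ w hw hwD hxσ)⟩⟩
  refine hcC.antisymm fun z hz => ?_
  by_contra hzc
  obtain ⟨w, -, hw, hw'⟩ := isPreconnected_closed_iff.1 isPreconnected_connectedComponentIn
    _ _ hDclosed hD'closed (fun w hw => (em (w ∈ Λ.mkQ '' c)).imp_right fun h => ⟨hw, h⟩)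
    ⟨Λ.mkQ y, hy, mem_image_of_mem _ (mem_connectedComponentIn hy)⟩ ⟨z, hz, hz, hzc⟩
  exact hw'.2 hw

/-- A nonempty subset of a component of a sublevel set has a smaller periodicity lattice than that
component. -/
theorem periodicityLattice_mono (hK : K.IsPeriodic Λ) (hf : K.IsPeriodicFun Λ f) (t : ℝ)
    {x₀ : Space d ⧸ Λ} {C : Set (Space d ⧸ Λ)} (hne : C.Nonempty)
    (hCC' : C ⊆ connectedComponentIn (K.torusSublevel Λ f t) x₀) :
    periodicityLattice Λ C ≤
      periodicityLattice Λ (connectedComponentIn (K.torusSublevel Λ f t) x₀) := by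
  rintro u ⟨hu, huC⟩
  refine ⟨hu, fun c' hc' => ?_⟩
  obtain ⟨x, hx⟩ := hne
  have himg := image_shadow hK hf t hc'
  -- As c' projects onto the whole component, it contains a lift z of the chosen point of C.
  obtain ⟨z, hz, rfl⟩ := himg.symm ▸ hCC' hx
  obtain ⟨y, hy, rfl⟩ := hc'
  set P := Λ.mkQ ⁻¹' connectedComponentIn (K.torusSublevel Λ f t) x₀ with hP
  have hzP : z ∈ P := connectedComponentIn_subset _ _ hz
  -- The translation preserves the shadow of C through z, and that shadow lies in the shadow of the
  -- larger component through z.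
  have hzu : z + u ∈ connectedComponentIn P z := by
    have h := huC _ ⟨z, hx, rfl⟩
    refine connectedComponentIn_mono z (preimage_mono hCC') (h ▸ mem_image_of_mem _ ?_)
    exact mem_connectedComponentIn hx
  -- Translation by u permutes the components of P; c' and its translate share the point z + u, so
  -- they coincide.
  rw [connectedComponentIn_eq hz,
    image_connectedComponentIn_add P u z hzP (image_add_preimage_mkQ Λ _ hu),
    connectedComponentIn_eq hzu]

end CellComplex

/-! ### Shift maps between merge trees -/

namespace MergeTree

variable {X : Type} [TopologicalSpace X] {S S' : ℝ → Set X}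

/-- The map of merge trees that raises heights by `ε` and follows the inclusions of sublevel
sets. -/
def shift (ε : ℝ) (h : ∀ s, S s ⊆ S' (s + ε)) : MergeTree S → MergeTree S' :=
  Quotient.map (fun p : SublevelSpace S =>
      (⟨(p.1.1, p.1.2 + ε), h _ p.2⟩ : SublevelSpace S')) <| by
    rintro ⟨⟨x, s⟩, hx⟩ ⟨⟨y, t⟩, hy⟩ ⟨hst, hxy⟩
    obtain rfl : s = t := hst
    refine ⟨rfl, connectedComponentIn_eq ?_⟩
    refine connectedComponentIn_mono x (h s) ?_
    change connectedComponentIn (S s) x = connectedComponentIn (S s) y at hxy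
    rw [hxy]
    exact mem_connectedComponentIn hy

theorem continuous_shift (ε : ℝ) (h : ∀ s, S s ⊆ S' (s + ε)) : Continuous (shift ε h) := by
  refine Continuous.quotient_map' ?_ _
  fun_prop

theorem height_shift (ε : ℝ) (h : ∀ s, S s ⊆ S' (s + ε)) (c : MergeTree S) :
    (shift ε h c).height = c.height + ε := by
  obtain ⟨p, rfl⟩ := Quotient.exists_rep c
  rfl

theorem component_subset_component_shift (ε : ℝ) (h : ∀ s, S s ⊆ S' (s + ε)) (c : MergeTree S) :
    c.component ⊆ (shift ε h c).component := by
  obtain ⟨p, rfl⟩ := Quotient.exists_rep c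
  exact connectedComponentIn_mono _ (h _)

/-- The composition of two opposite shifts sends a point to a point above it that contains it. -/
theorem covers_shift_shift {ε : ℝ} (hε : 0 ≤ ε) (h : ∀ s, S s ⊆ S' (s + ε))
    (h' : ∀ s, S' s ⊆ S (s + ε)) (c : MergeTree S) :
    c.height ≤ (shift ε h' (shift ε h c)).height ∧
      c.component ⊆ (shift ε h' (shift ε h c)).component := by
  refine ⟨?_, (component_subset_component_shift ε h c).trans
    (component_subset_component_shift ε h' _)⟩
  rw [height_shift, height_shift]
  linarith

theorem component_nonempty (c : MergeTree S) : c.component.Nonempty := by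
  obtain ⟨p, rfl⟩ := Quotient.exists_rep c
  exact ⟨p.1.1, mem_connectedComponentIn p.2⟩

theorem exists_component_eq (c : MergeTree S) :
    ∃ x, c.component = connectedComponentIn (S c.height) x := by
  obtain ⟨p, rfl⟩ := Quotient.exists_rep c
  exact ⟨p.1.1, rfl⟩

end MergeTree

/-! ### Stability -/

theorem interleavingDist_le {T T' : DecoratedTree} {ε : ℝ≥0} {φ : T.carrier → T'.carrier}
    {ψ : T'.carrier → T.carrier} (h : Compatible T T' ε φ ψ) : interleavingDist T T' ≤ ε :=
  iInf₂_le ε ⟨φ, ψ, h⟩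

theorem interleavingDist_self {T : DecoratedTree} (h : ∀ c, T.covers c c) :
    interleavingDist T T = 0 :=
  nonpos_iff_eq_zero.1 <| interleavingDist_le (ε := 0) (φ := id) (ψ := id)
    ⟨continuous_id, continuous_id, by simp, by simp, h, h, fun _ => Monomial.le_refl _,
      fun _ => Monomial.le_refl _⟩

/-- For the identity every fibre is a single point, so frequencies are divided by 1 and only the
distance of a subtree to itself is involved. -/
theorem splinters_self {T : DecoratedTree} (h : ∀ c, T.covers c c) : Splinters T T := by
  refine ⟨id, continuous_id, Function.surjective_id, fun _ => rfl, fun c => ?_⟩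
  simp only [preimage_id, finite_singleton, mem_singleton_iff, forall_eq, ncard_singleton,
    image_id, true_and]
  exact ⟨interleavingDist_self fun a => h a.1, by simp [Monomial.divNat]⟩

theorem covers_refl (Λ : Submodule ℤ (Space d)) (K : CellComplex d) (f : K.cells → ℝ)
    (c : (periodicMergeTree Λ K f).carrier) : (periodicMergeTree Λ K f).covers c c :=
  ⟨le_rfl, Subset.rfl⟩

theorem mem_splinterClass_self {T : DecoratedTree} (hT : IsPeriodicMergeTree d T) :
    T ∈ splinterClass d T := by
  have h : Splinters T T := by
    obtain ⟨Λ, _, _, K, f, _, _, _, rfl⟩ := hT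
    exact splinters_self (covers_refl Λ K f)
  exact ⟨hT, T, hT, h, h⟩

/-- The chain with the single pair (T, T') competes in the infimum; it has no intermediate
equivalences to check. -/
theorem interleavingPseudoDist_splinterClass_le {T T' : DecoratedTree}
    (hT : IsPeriodicMergeTree d T) (hT' : IsPeriodicMergeTree d T') :
    interleavingPseudoDist d (splinterClass d T) (splinterClass d T') ≤ interleavingDist T T' :=
  sInf_le ⟨0, fun _ => T, fun _ => T', fun _ => hT, fun _ => hT', mem_splinterClass_self hT,
    mem_splinterClass_self hT', fun i => i.elim0, by simp⟩

theorem freq_shift_le (Λ : Submodule ℤ (Space d)) [DiscreteTopology Λ] {K : CellComplex d}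
    (hK : K.IsPeriodic Λ) {f g : K.cells → ℝ} (hg : K.IsPeriodicFun Λ g) (ε : ℝ)
    (h : ∀ s, K.torusSublevel Λ f s ⊆ K.torusSublevel Λ g (s + ε))
    (c : MergeTree (K.torusSublevel Λ f)) :
    shadowMonomial Λ (MergeTree.shift ε h c).component ≤ shadowMonomial Λ c.component := by
  apply shadowMonomial_anti
  have hsub := MergeTree.component_subset_component_shift ε h c
  obtain ⟨x, hx⟩ := MergeTree.exists_component_eq (MergeTree.shift ε h c)
  rw [hx] at hsub ⊢
  exact CellComplex.periodicityLattice_mono hK hg _ c.component_nonempty hsub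

theorem torusSublevel_subset (Λ : Submodule ℤ (Space d)) (K : CellComplex d)
    {f g : K.cells → ℝ} {ε : ℝ} (h : ∀ σ, |f σ - g σ| ≤ ε) (s : ℝ) :
    K.torusSublevel Λ f s ⊆ K.torusSublevel Λ g (s + ε) := by
  refine image_mono ?_
  rintro x ⟨σ, hσ, hx⟩
  exact ⟨σ, by linarith [(abs_le.1 (h σ)).1], hx⟩

theorem interleavingDist_le_of_abs_sub_le (Λ : Submodule ℤ (Space d)) [DiscreteTopology Λ]
    {K : CellComplex d} (hK : K.IsPeriodic Λ) {f g : K.cells → ℝ} (hf : K.IsPeriodicFun Λ f)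
    (hg : K.IsPeriodicFun Λ g) (ε : ℝ≥0) (h : ∀ σ, |f σ - g σ| ≤ ε) :
    interleavingDist (periodicMergeTree Λ K f) (periodicMergeTree Λ K g) ≤ ε := by
  have hfg := torusSublevel_subset Λ K h
  have hgf := torusSublevel_subset Λ K fun σ => (abs_sub_comm (g σ) (f σ)).trans_le (h σ)
  exact interleavingDist_le (φ := MergeTree.shift (ε : ℝ) hfg) (ψ := MergeTree.shift (ε : ℝ) hgf)
    ⟨MergeTree.continuous_shift _ _, MergeTree.continuous_shift _ _,
      MergeTree.height_shift _ _, MergeTree.height_shift _ _,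
      MergeTree.covers_shift_shift ε.coe_nonneg hfg hgf,
      MergeTree.covers_shift_shift ε.coe_nonneg hgf hfg,
      freq_shift_le Λ hK hg _ hfg, freq_shift_le Λ hK hf _ hgf⟩

theorem abs_sub_le_supDist {ι : Type} {f g : ι → ℝ} (h : supDist f g ≠ ⊤) (i : ι) :
    |f i - g i| ≤ (supDist f g).toNNReal := by
  have hi : ENNReal.ofReal |f i - g i| ≤ supDist f g :=
    le_iSup (fun i => ENNReal.ofReal |f i - g i|) i
  exact (ENNReal.ofReal_le_iff_le_toReal h).1 hi

end PeriodicMerge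

theorem mainTheorem3 (d : ℕ) (Λ : Submodule ℤ (Space d)) [DiscreteTopology Λ] [IsZLattice ℝ Λ]
    (K : CellComplex d) (hK : K.IsPeriodic Λ) (f g : K.cells → ℝ)
    (hf : K.IsFilter f) (hfΛ : K.IsPeriodicFun Λ f)
    (hg : K.IsFilter g) (hgΛ : K.IsPeriodicFun Λ g) :
    interleavingDist (periodicMergeTree Λ K f) (periodicMergeTree Λ K g) ≤ supDist f g ∧
    interleavingPseudoDist d (splinterClass d (periodicMergeTree Λ K f))
      (splinterClass d (periodicMergeTree Λ K g)) ≤ supDist f g := by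
  have hI : interleavingDist (periodicMergeTree Λ K f) (periodicMergeTree Λ K g) ≤
      supDist f g := by
    -- In the finite case the supremum itself bounds every |f σ - g σ|, so it serves as ε directly
    -- and no limit is needed.
    by_cases h : supDist f g = ⊤
    · exact h ▸ le_top
    · exact (interleavingDist_le_of_abs_sub_le Λ hK hfΛ hgΛ _ (abs_sub_le_supDist h)).trans_eq
        (ENNReal.coe_toNNReal h)
  exact ⟨hI, (interleavingPseudoDist_splinterClass_le
    ⟨Λ, inferInstance, inferInstance, K, f, hK, hf, hfΛ, rfl⟩
    ⟨Λ, inferInstance, inferInstance, K, g, hK, hg, hgΛ, rfl⟩).trans hI⟩
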